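/- Conventions. A finite $\Sigma$-labelled binary tree is a nonempty finite prefix-closed set $T\subseteq\{0,1\}^*$ with a labelling $\lambda:T\to\Sigma$; its frontier is $T\{0,1\}\setminus T$. A tree automaton over a finite alphabet $\Sigma$ has a finite state set $Q$, initial states $I$, final states $F$ and transitions $\Delta\subseteq(Q\setminus F)\times\Sigma\times Q\times Q$; it accepts $(T,\lambda)$ if some map $\rho:T\cup T\{0,1\}\to Q$ satisfies $\rho(\varepsilon)\in I$, $\rho(u)\in F$ on the frontier, and $(\rho(u),\lambda(u),\rho(u0),\rho(u1))\in\Delta$ for $u\in T$. A set of trees is regular if it is the set of trees accepted by a tree automaton. The convolution of trees $t_1,\dots,t_n$ is the tree on the union of their domains whose label at $u$ is the tuple of the labels of $u$ in $t_1,\dots,t_n$, with a padding symbol $\diamond$ in the $i$-th place if $u\notin t_i$. A relational structure is tree-automatic if it is isomorphic to one whose domain is a regular set of trees over a finite alphabet and, for each of whose relations, the set of convolutions of its tuples is regular. Partial orders are structures over the signature $\{\le\}$; all structures are countable. The rank of an element of a well-founded partial order $\mathfrak P$ is $\operatorname{rank}(p)=\sup\{\operatorname{rank}(p')+1\mid p'<p\}$,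 and $\operatorname{rank}(\mathfrak P)=\sup\{\operatorname{rank}(p)+1\mid p\in\mathfrak P\}$ ($\sup\emptyset=0$). Let $\mathfrak A,\mathfrak B_1,\dots,\mathfrak B_n$ be relational structures over the same signature. $\mathfrak A$ is a sum-augmentation of $(\mathfrak B_1,\dots,\mathfrak B_n)$ if its domain is a disjoint union $A_1\sqcup\dots\sqcup A_n$ such that $A_i$ induces a substructure isomorphic to $\mathfrak B_i$ for each $i$. It is a box-augmentation, witnessed by a bijection $\eta:\prod_i B_i\to A$, if fixing all arguments of $\eta$ but the $k$-th always gives an embedding of $\mathfrak B_k$ into $\mathfrak A$. For an $r$-ary relation symbol $R$, a finite $R$-coloring of a structure is a map from $r$-tuples to a finite set such that equally colored tuples agree on membership in $R$. The box-augmentation is tamely colorable if some witness $\eta$ has the property that for every relation symbol $R$, say of arity $r$, there are finite $R$-colorings $\sigma_i$ of the $\mathfrak B_i$ for which $(\eta(b_{1,1},\dots,b_{1,n}),\dots,\eta(b_{r,1},\dots,b_{r,n}))\mapsto(\sigma_i(b_{1,i},\dots,b_{r,i}))_{1\le i\le n}$ is a finite $R$-coloring of $\mathfrak A$. Let $\mathcal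 C$ be a class of well-founded partial orders. An ordinal $\gamma$ is rank-sum-indecomposable for $\mathcal C$ if, whenever $\mathfrak A\in\mathcal C$ has rank $\gamma$ and is a sum-augmentation of $(\mathfrak B_1,\dots,\mathfrak B_m)$, $m\ge1$, some $\mathfrak B_i$ lies in $\mathcal C$ and has rank $\gamma$. An interval $[\alpha_1,\alpha_2]$ is rank-tamely-colorable-box-indecomposable for $\mathcal C$ if, whenever $\mathfrak A\in\mathcal C$ has rank $\alpha_2$ and is a tamely colorable box-augmentation of $(\mathfrak B_1,\dots,\mathfrak B_m)$, $m\ge1$, some $\mathfrak B_i$ lies in $\mathcal C$ and has rank in $[\alpha_1,\alpha_2]$. A Delhommé sequence for $\mathcal C$ is a strictly increasing sequence $\gamma_0<\gamma_1<\cdots$ of rank-sum-indecomposable ordinals all of whose intervals $[\gamma_i,\gamma_{i+1}]$ are rank-tamely-colorable-box-indecomposable. Statement. (1) For every ordinal $\alpha<\omega^{\omega^\omega}$ let $\mathfrak P_\alpha$ be the partial order on $\{(\beta,k)\mid\beta<\alpha,\ k\in\mathbb N\}$ whose strict order is $(\beta,k)\prec(\beta',k')\iff\beta<\beta'\text{ and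 }k>k'$ (the direct product of $\alpha$ and $\omega^*$ as strict orders). Then $\mathfrak P_\alpha$ is tree-automatic and well-founded, has rank exactly $\alpha$, and has no infinite chain. For each $\beta<\alpha$ the suborder on $\{(\beta,k)\mid k\in\mathbb N\}$ is isomorphic to the antichain $(\omega^*,=)$, for each $k\in\mathbb N$ the suborder on $\{(\beta,k)\mid\beta<\alpha\}$ is isomorphic to the antichain $(\alpha,=)$, and $\mathfrak P_\alpha$ is a tamely colorable box-augmentation of the two antichains $((\alpha,=),(\omega^*,=))$. (2) Every nonempty countable antichain has rank $1$. (3) Consequently Delhommé's decomposition technique cannot bound the ranks of general well-founded partial orders: if $\mathcal C$ is a class of well-founded partial orders that contains all tree-automatic ones, then no interval $[\alpha_1,\alpha_2]$ with $1<\alpha_1\le\alpha_2<\omega^{\omega^\omega}$ is rank-tamely-colorable-box-indecomposable for $\mathcal C$, and there is no Delhommé sequence for $\mathcal C$ all of whose terms are below $\omega^{\omega^\omega}$. For the class of all well-founded partial orders (with countable domain) both assertions hold with $\omega_1$ in place of $\omega^{\omega^\omega}$. -/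

import Mathlib

namespace TreeAut

open FirstOrder CategoryTheory

/-! ### Finite labelled binary trees, tree automata, tree-automatic structures

A nonempty finite prefix-closed set `T ⊆ {0,1}*` with a labelling `T → A` is represented by a
term `t : BinaryTree A` with `t ≠ nil`: the `node`s of `t` are the elements of `T`, and the
occurrences of `nil` in `t` are the elements of the frontier `T{0,1} \ T`. -/

/-- A nondeterministic top-down tree automaton over the alphabet `A` with state set `Q`.
No transition starts in a final state. -/
structure TreeAutomaton (A Q : Type) where
  initial : Set Q
  final : Set Q
  /-- `trans q a q₀ q₁` is the transition `(q, a, q₀, q₁)`. -/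
  trans : Q → A → Q → Q → Prop
  not_final_of_trans : ∀ {q a q₀ q₁}, trans q a q₀ q₁ → q ∉ final

/-- There is a run on `t` that starts in state `q` at the root, respects the transition relation
at every node and assumes final states on the whole frontier. -/
def TreeAutomaton.AcceptsFrom {A Q : Type} (𝓐 : TreeAutomaton A Q) : Q → BinaryTree A → Prop
  | q, .nil => q ∈ 𝓐.final
  | q, .node a l r =>
      ∃ q₀ q₁, 𝓐.trans q a q₀ q₁ ∧ 𝓐.AcceptsFrom q₀ l ∧ 𝓐.AcceptsFrom q₁ r

/-- The set of (nonempty) trees that admit a successful run. -/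
def TreeAutomaton.language {A Q : Type} (𝓐 : TreeAutomaton A Q) : Set (BinaryTree A) :=
  {t | t ≠ .nil ∧ ∃ q ∈ 𝓐.initial, 𝓐.AcceptsFrom q t}

/-- Regular sets of finite labelled trees. -/
def IsRegular {A : Type} (S : Set (BinaryTree A)) : Prop :=
  ∃ (Q : Type) (_ : Finite Q) (𝓐 : TreeAutomaton A Q), 𝓐.language = S

/-- The label at the root; `none` plays the role of the padding symbol `⋄`. -/
def rootLabel {A : Type} : BinaryTree A → Option A
  | .nil => none
  | .node a _ _ => some a

theorem numNodes_left_le {A : Type} (t : BinaryTree A) : t.left.numNodes ≤ t.numNodes := by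
  cases t <;> simp [BinaryTree.left]; omega

theorem numNodes_right_le {A : Type} (t : BinaryTree A) : t.right.numNodes ≤ t.numNodes := by
  cases t <;> simp [BinaryTree.right]; omega

theorem numNodes_left_lt {A : Type} {t : BinaryTree A} (h : t ≠ .nil) :
    t.left.numNodes < t.numNodes := by
  cases t <;> simp [BinaryTree.left] at *

theorem numNodes_right_lt {A : Type} {t : BinaryTree A} (h : t ≠ .nil) :
    t.right.numNodes < t.numNodes := by
  cases t <;> simp [BinaryTree.right] at *

open Classical in
/-- The convolution `t₁ ⊗ ⋯ ⊗ tₙ`: its domain is the union of the domains, and a node is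
labelled by the tuple of its labels, padded by `none`. -/
noncomputable def convolution {A : Type} {n : ℕ} (t : Fin n → BinaryTree A) :
    BinaryTree (Fin n → Option A) :=
  if ∃ i, t i ≠ .nil then
    .node (fun i => rootLabel (t i))
      (convolution fun i => (t i).left) (convolution fun i => (t i).right)
  else .nil
termination_by ∑ i, (t i).numNodes
decreasing_by
  · obtain ⟨i, hi⟩ := ‹∃ i, t i ≠ .nil›
    exact Finset.sum_lt_sum (fun j _ => numNodes_left_le (t j))
      ⟨i, Finset.mem_univ i, numNodes_left_lt hi⟩
  · obtain ⟨i, hi⟩ := ‹∃ i, t i ≠ .nil›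
    exact Finset.sum_lt_sum (fun j _ => numNodes_right_le (t j))
      ⟨i, Finset.mem_univ i, numNodes_right_lt hi⟩

/-- Tree-automatic relations on trees. -/
def IsTreeAutomaticRel {A : Type} {n : ℕ} (R : Set (Fin n → BinaryTree A)) : Prop :=
  IsRegular (convolution '' R)

variable {L : FirstOrder.Language.{0, 0}}

/-- A relational structure is tree-automatic if it is isomorphic to a structure whose domain is
a regular set `S` of trees over a finite alphabet and whose relations are all tree-automatic. -/
def IsTreeAutomatic [L.IsRelational] (𝔐 : Bundled.{0} L.Structure) : Prop :=
  ∃ (A : Type) (_ : Finite A) (S : Set (BinaryTree A)) (_ : L.Structure S),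
    IsRegular S ∧
    (∀ (n : ℕ) (R : L.Relations n), IsTreeAutomaticRel
      {t | ∃ x : Fin n → S, Language.Structure.RelMap R x ∧ t = fun i => (x i : BinaryTree A)}) ∧
    Nonempty (𝔐 ≃[L] S)

/-! ### Sum-augmentations and (tamely colorable) box-augmentations -/

/-- `𝔄` is a sum-augmentation of `(𝔅₁, …, 𝔅ₙ)`: the domain is partitioned into `n` parts
(the fibres of `part`), the `i`-th of which induces a copy of `𝔅ᵢ`. -/
def IsSumAugmentation [L.IsRelational] (𝔄 : Bundled.{0} L.Structure) {n : ℕ}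
    (𝔅 : Fin n → Bundled.{0} L.Structure) : Prop :=
  ∃ part : 𝔄 → Fin n, ∀ i, ∃ f : 𝔅 i ↪[L] 𝔄, Set.range f = part ⁻¹' {i}

/-- The bijection `η` witnesses that `𝔄` is a box-augmentation of `(𝔅₁, …, 𝔅ₙ)`: fixing all
coordinates but the `k`-th one (to those of `d`) yields an embedding of `𝔅ₖ` into `𝔄`. -/
def IsBoxWitness [L.IsRelational] (𝔄 : Bundled.{0} L.Structure) {n : ℕ}
    (𝔅 : Fin n → Bundled.{0} L.Structure) (η : (∀ i, 𝔅 i) ≃ 𝔄) : Prop :=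
  ∀ (k : Fin n) (d : ∀ i, 𝔅 i), ∃ f : 𝔅 k ↪[L] 𝔄, ∀ e, f e = η (Function.update d k e)

/-- `σ` is a finite `R`-coloring of `𝔄`. -/
def IsFiniteColoring (𝔄 : Bundled.{0} L.Structure) {r : ℕ} (R : L.Relations r) {C : Type}
    (σ : (Fin r → 𝔄) → C) : Prop :=
  Finite C ∧ ∀ x y, σ x = σ y → (Language.Structure.RelMap R x ↔ Language.Structure.RelMap R y)

/-- `𝔄` is a tamely colorable box-augmentation of `(𝔅₁, …, 𝔅ₙ)`. -/
def IsTamelyColorableBoxAugmentation [L.IsRelational] (𝔄 : Bundled.{0} L.Structure) {n : ℕ}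
    (𝔅 : Fin n → Bundled.{0} L.Structure) : Prop :=
  ∃ η : (∀ i, 𝔅 i) ≃ 𝔄, IsBoxWitness 𝔄 𝔅 η ∧
    ∀ (r : ℕ) (R : L.Relations r),
      ∃ (C : Fin n → Type) (σ : ∀ i, (Fin r → 𝔅 i) → C i),
        (∀ i, IsFiniteColoring (𝔅 i) R (σ i)) ∧
        IsFiniteColoring 𝔄 R
          (fun (a : Fin r → 𝔄) (i : Fin n) => σ i (fun j => η.symm (a j) i))

/-! ### Indecomposability -/

/-- The ordinal `α` is `ν`-sum-indecomposable for the class `𝒞` ranked by `ν`. -/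
def IsSumIndecomposable [L.IsRelational] (𝒞 : Set (Bundled.{0} L.Structure))
    (ν : 𝒞 → Ordinal.{0}) (α : Ordinal.{0}) : Prop :=
  ∀ 𝔄 : 𝒞, ν 𝔄 = α → ∀ (m : ℕ) (𝔅 : Fin m → Bundled.{0} L.Structure), 0 < m →
    IsSumAugmentation 𝔄.1 𝔅 → ∃ (i : Fin m) (h : 𝔅 i ∈ 𝒞), ν ⟨𝔅 i, h⟩ = α

/-- The interval `[α₁, α₂]` is `ν`-tamely-colorable-box-indecomposable for the class `𝒞`
ranked by `ν`. -/
def IsBoxIndecomposable [L.IsRelational] (𝒞 : Set (Bundled.{0} L.Structure))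
    (ν : 𝒞 → Ordinal.{0}) (α₁ α₂ : Ordinal.{0}) : Prop :=
  ∀ 𝔄 : 𝒞, ν 𝔄 = α₂ → ∀ (m : ℕ) (𝔅 : Fin m → Bundled.{0} L.Structure), 0 < m →
    IsTamelyColorableBoxAugmentation 𝔄.1 𝔅 →
      ∃ (i : Fin m) (h : 𝔅 i ∈ 𝒞), ν ⟨𝔅 i, h⟩ ∈ Set.Icc α₁ α₂

/-- The sequences of ordinals to which Delhommé's decomposition technique applies. -/
structure IsDelhommeSequence [L.IsRelational] (𝒞 : Set (Bundled.{0} L.Structure))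
    (ν : 𝒞 → Ordinal.{0}) (a : ℕ → Ordinal.{0}) : Prop where
  strictMono : StrictMono a
  sum_indecomposable : ∀ i, IsSumIndecomposable 𝒞 ν (a i)
  box_indecomposable : ∀ i, IsBoxIndecomposable 𝒞 ν (a i) (a (i + 1))

/-! ### Partial orders as structures, and their rank -/

/-- A partial order, as a structure over the signature with one binary symbol `≤`. -/
def orderStr (P : Type) [PartialOrder P] : Bundled.{0} Language.order.Structure :=
  ⟨P, Language.orderStructure P⟩

/-- The relation `≤` of an `{≤}`-structure. -/
def leRel (𝔓 : Bundled.{0} Language.order.Structure) (x y : 𝔓) : Prop :=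
  Language.Structure.RelMap (Language.leSymb : Language.order.Relations 2) ![x, y]

/-- The strict part of the relation `≤` of an `{≤}`-structure. -/
def ltRel (𝔓 : Bundled.{0} Language.order.Structure) (x y : 𝔓) : Prop :=
  leRel 𝔓 x y ∧ x ≠ y

/-- The class of all well-founded partial orders (with countable domain). -/
structure IsWellFoundedOrder (𝔓 : Bundled.{0} Language.order.Structure) : Prop where
  countable : Countable 𝔓
  partialOrder : IsPartialOrder 𝔓 (leRel 𝔓)
  wf : WellFounded (ltRel 𝔓)

/-- The rank `sup {rank(p) + 1 | p ∈ 𝔓}` of a well-founded partial order, where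
`rank(p) = sup {rank(p') + 1 | p' < p}`. -/
noncomputable def rank (𝔓 : Bundled.{0} Language.order.Structure) (h : IsWellFoundedOrder 𝔓) :
    Ordinal.{0} :=
  ⨆ p : 𝔓, Order.succ (h.wf.apply p).rank

/-- The restriction of the rank to a class `𝒞` of well-founded partial orders. -/
noncomputable def rankOn {𝒞 : Set (Bundled.{0} Language.order.Structure)}
    (h𝒞 : 𝒞 ⊆ {𝔓 | IsWellFoundedOrder 𝔓}) (𝔓 : 𝒞) : Ordinal.{0} :=
  rank 𝔓.1 (h𝒞 𝔓.2)

/-! ### The orders of the example -/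

/-- The direct product of two orders as strict orders: `p < q` iff both coordinates of `p` are
strictly smaller than those of `q`, and `≤` is the reflexive closure of `<`. -/
@[ext]
structure StrictProduct (X Y : Type) where
  fst : X
  snd : Y

instance {X Y : Type} [PartialOrder X] [PartialOrder Y] : PartialOrder (StrictProduct X Y) where
  le p q := p = q ∨ (p.fst < q.fst ∧ p.snd < q.snd)
  lt p q := p.fst < q.fst ∧ p.snd < q.snd
  le_refl p := Or.inl rfl
  le_trans p q r := by
    rintro (rfl | h) (rfl | h')
    · exact Or.inl rfl
    · exact Or.inr h'
    · exact Or.inr h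
    · exact Or.inr ⟨h.1.trans h'.1, h.2.trans h'.2⟩
  le_antisymm p q := by
    rintro (rfl | h) (h' | h')
    · rfl
    · rfl
    · exact h'.symm
    · exact absurd (h.1.trans h'.1) (lt_irrefl _)
  lt_iff_le_not_ge p q := by
    constructor
    · intro h
      refine ⟨Or.inr h, ?_⟩
      rintro (rfl | h')
      · exact lt_irrefl _ h.1
      · exact lt_irrefl _ (h.1.trans h'.1)
    · rintro ⟨rfl | h, h'⟩
      · exact absurd (Or.inl rfl) h'
      · exact h

/-- The direct product of the ordinal `α` and `ω*` (the reverse of `ω`) as strict orders. -/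
abbrev OrdinalTimesOmegaStar (α : Ordinal.{0}) : Type := StrictProduct α.ToType ℕᵒᵈ

/-- The antichain `(X, =)` on the set `X`. -/
def Antichain (X : Type) : Type := X

instance {X : Type} : PartialOrder (Antichain X) where
  le x y := x = y
  le_refl _ := rfl
  le_trans _ _ _ := Eq.trans
  le_antisymm _ _ h _ := h

end TreeAut

namespace TreeAut

/-! ### Recognizable functions of tuples of trees -/

/-! In the strict product of `α` and `ω*`, distinct comparable elements differ in both coordinates,
so fixing either coordinate leaves an antichain, of rank at most 1. Yet `(β, k)` has rank `β`: every
`(c, k + 1)` with `c < β` lies below it, since `ω*` always has room further down. The product is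
tamely colorable because the comparisons of coordinates in the linear orders `α` and `ω*` are finite
colorings that together decide its order (`StrictProduct.isTamelyColorableBoxAugmentation`). An
order of rank `α₂` thus splits into factors of rank 1, which refutes box-indecomposability of `[α₁,
α₂]` when `1 < α₁`.

For tree-automaticity, an ordinal below `ω ^ ω ^ (n + 1)` is a finite numeral in base `ω ^ ω ^ n`,
whose digits are coded recursively by left subtrees along the right spine. Numerals compare
lexicographically (`cmp_codeVal_succ`), which a bottom-up automaton can do. Automata are handled
through `IsRecognizable`, a notion closed under products, reindexing and recursion;
`IsRecognizable.isTreeAutomaticRel` translates back to convolutions. -/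

/-- The value of a bottom-up computation on a tree. -/
def foldTree {A D : Type} (d : D) (g : A → D → D → D) : BinaryTree A → D
  | .nil => d
  | .node a l r => g a (foldTree d g l) (foldTree d g r)

/-- A deterministic bottom-up computation with finitely many values recognizes a regular set. -/
theorem isRegular_foldTree {A D : Type} [Finite D] (d : D) (g : A → D → D → D) (F : Set D) :
    IsRegular {t : BinaryTree A | t ≠ .nil ∧ foldTree d g t ∈ F} := by
  classical
  -- State `some x` guesses that the subtree has value `x`. The frontier gets the separate state
  -- `none`, read as `d`, because no transition may leave a final state while a nonempty subtree may
  -- well have value `d`.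
  let 𝓐 : TreeAutomaton A (Option D) :=
    { initial := some '' F
      final := {none}
      trans := fun q a q₀ q₁ => q = some (g a (q₀.getD d) (q₁.getD d))
      not_final_of_trans := by rintro _ _ _ _ rfl; simp }
  have key : ∀ (t : BinaryTree A) (q : Option D),
      𝓐.AcceptsFrom q t ↔ q = if t = .nil then none else some (foldTree d g t) := by
    intro t
    induction t with
    | nil => intro q; simp [TreeAutomaton.AcceptsFrom, 𝓐]
    | node a l r hl hr =>
      have hd : ∀ t : BinaryTree A,
          (if t = .nil then none else some (foldTree d g t)).getD d = foldTree d g t := by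
        intro t; cases t <;> simp [foldTree]
      intro q
      simp only [TreeAutomaton.AcceptsFrom, hl, hr]
      constructor
      · rintro ⟨q₀, q₁, h, rfl, rfl⟩
        simpa [𝓐, hd, foldTree] using h
      · rintro rfl
        exact ⟨_, _, by simp [𝓐, hd, foldTree], rfl, rfl⟩
  refine ⟨Option D, inferInstance, 𝓐, ?_⟩
  ext t
  simp only [TreeAutomaton.language, Set.mem_ofPred_eq, key]
  refine and_congr_right fun ht => ?_
  simp [ht, 𝓐]

theorem rootLabel_eq_none {A : Type} {t : BinaryTree A} : rootLabel t = none ↔ t = .nil := by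
  cases t <;> simp [rootLabel]

/-- The function `f` is computed, up to a final relabelling, by a deterministic bottom-up
computation on convolutions with finitely many values. -/
def IsRecognizable {A D : Type} {n : ℕ} (f : (Fin n → BinaryTree A) → D) : Prop :=
  ∃ (E : Type) (_ : Finite E) (e : (Fin n → BinaryTree A) → E)
    (g : (Fin n → Option A) → E → E → E) (h : E → D),
    (∀ t, (∃ i, t i ≠ .nil) → e t = g (fun i => rootLabel (t i))
      (e fun i => (t i).left) (e fun i => (t i).right)) ∧
    ∀ t, f t = h (e t)

namespace IsRecognizable

variable {A D D' : Type} {n : ℕ} {f : (Fin n → BinaryTree A) → D}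

theorem map (hf : IsRecognizable f) (k : D → D') : IsRecognizable fun t => k (f t) := by
  obtain ⟨E, hE, e, g, h, he, hh⟩ := hf
  exact ⟨E, hE, e, g, k ∘ h, he, fun t => by simp [hh]⟩

theorem prodMk {f' : (Fin n → BinaryTree A) → D'} (hf : IsRecognizable f)
    (hf' : IsRecognizable f') : IsRecognizable fun t => (f t, f' t) := by
  obtain ⟨E, hE, e, g, h, he, hh⟩ := hf
  obtain ⟨E', hE', e', g', h', he', hh'⟩ := hf'
  exact ⟨E × E', inferInstance, fun t => (e t, e' t),
    fun a x y => (g a x.1 y.1, g' a x.2 y.2), fun x => (h x.1, h' x.2),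
    fun t ht => by simp only [he t ht, he' t ht], fun t => by simp [hh, hh']⟩

/-- Functions defined by recursion from recognizable functions are recognizable. -/
theorem of_recursion [Finite D'] (hf : IsRecognizable f) {r : (Fin n → BinaryTree A) → D'}
    (G : (Fin n → Option A) → D → D → D' → D' → D')
    (hr : ∀ t, (∃ i, t i ≠ .nil) → r t = G (fun i => rootLabel (t i))
      (f fun i => (t i).left) (f fun i => (t i).right)
      (r fun i => (t i).left) (r fun i => (t i).right)) : IsRecognizable r := by
  obtain ⟨E, hE, e, g, h, he, hh⟩ := hf
  exact ⟨E × D', inferInstance, fun t => (e t, r t),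
    fun a x y => (g a x.1 y.1, G a (h x.1) (h y.1) x.2 y.2), Prod.snd,
    fun t ht => by simp only [he t ht, hr t ht, hh], fun t => rfl⟩

theorem const (n : ℕ) (d : D) : IsRecognizable fun _ : Fin n → BinaryTree A => d :=
  ⟨Unit, inferInstance, fun _ => (), fun _ _ _ => (), fun _ => d, fun _ _ => rfl, fun _ => rfl⟩

theorem comp_reindex (hf : IsRecognizable f) {m : ℕ} (s : Fin n → Fin m) :
    IsRecognizable fun t : Fin m → BinaryTree A => f fun i => t (s i) := by
  classical
  obtain ⟨E, hE, e, g, h, he, hh⟩ := hf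
  refine ⟨E, hE, fun t => e fun i => t (s i),
    -- A node may be present only because of trees outside the range of `s`. All selected trees are
    -- then empty there, and the value is that of the empty tuple.
    fun a x y => if ∃ i, a (s i) ≠ none then g (fun i => a (s i)) x y else e fun _ => .nil, h,
    fun t _ => ?_, fun t => by simp [hh]⟩
  simp only [Ne, rootLabel_eq_none]
  split_ifs with hs
  · exact he _ hs
  · simp only [not_exists, not_not] at hs
    simp only [hs]

/-- With a single tree no padding occurs, so the computation runs on the tree itself. This serves
the domain of a presentation, whose elements are plain trees. -/
theorem isRegular {p : (Fin 1 → BinaryTree A) → Prop} (hp : IsRecognizable p) :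
    IsRegular {t : BinaryTree A | t ≠ .nil ∧ p fun _ => t} := by
  obtain ⟨E, hE, e, g, h, he, hh⟩ := hp
  convert isRegular_foldTree (e fun _ => .nil) (fun a => g fun _ => some a) {x | h x} using 4 with t
  have : ∀ t : BinaryTree A,
      e (fun _ => t) = foldTree (e fun _ => .nil) (fun a => g fun _ => some a) t := by
    intro t
    induction t with
    | nil => rfl
    | node a l r hl hr =>
      rw [he _ ⟨0, by simp⟩]
      simp only [rootLabel, BinaryTree.left, BinaryTree.right, foldTree, hl, hr]
  rw [hh, this]; rfl

end IsRecognizable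

/-! ### Convolutions and their components -/

/-- The `i`-th component of a convolution. -/
def component {A : Type} {n : ℕ} (i : Fin n) : BinaryTree (Fin n → Option A) → BinaryTree A
  | .nil => .nil
  | .node a l r => match a i with
    | none => .nil
    | some x => .node x (component i l) (component i r)

theorem convolution_of_exists {A : Type} {n : ℕ} {t : Fin n → BinaryTree A}
    (h : ∃ i, t i ≠ .nil) : convolution t = .node (fun i => rootLabel (t i))
      (convolution fun i => (t i).left) (convolution fun i => (t i).right) := by
  rw [convolution, if_pos h]

theorem convolution_eq_nil {A : Type} {n : ℕ} {t : Fin n → BinaryTree A}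
    (h : ¬ ∃ i, t i ≠ .nil) : convolution t = .nil := by
  rw [convolution, if_neg h]

/-- Induction along the recursion that defines convolutions. -/
theorem convolution_induction {A : Type} {n : ℕ} {P : (Fin n → BinaryTree A) → Prop}
    (nil : ∀ t, (¬ ∃ i, t i ≠ .nil) → P t)
    (node : ∀ t, (∃ i, t i ≠ .nil) → P (fun i => (t i).left) → P (fun i => (t i).right) → P t)
    (t : Fin n → BinaryTree A) : P t := by
  induction hk : ∑ i, (t i).numNodes using Nat.strong_induction_on generalizing t with
  | _ k ih =>
    subst hk
    by_cases h : ∃ i, t i ≠ .nil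
    · obtain ⟨i, hi⟩ := id h
      exact node t h
        (ih _ (Finset.sum_lt_sum (fun j _ => numNodes_left_le (t j))
          ⟨i, Finset.mem_univ i, numNodes_left_lt hi⟩) _ rfl)
        (ih _ (Finset.sum_lt_sum (fun j _ => numNodes_right_le (t j))
          ⟨i, Finset.mem_univ i, numNodes_right_lt hi⟩) _ rfl)
    · exact nil t h

theorem component_convolution {A : Type} {n : ℕ} (t : Fin n → BinaryTree A) (i : Fin n) :
    component i (convolution t) = t i := by
  induction t using convolution_induction with
  | nil t h =>
    rw [convolution_eq_nil h]
    simp only [not_exists, not_not] at h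
    rw [h i, component]
  | node t h hl hr =>
    rw [convolution_of_exists h, component, hl, hr]
    cases h : t i <;> simp [h, rootLabel, BinaryTree.left, BinaryTree.right]

/-- The trees that are convolutions. -/
def IsConvolution {A : Type} {n : ℕ} : BinaryTree (Fin n → Option A) → Prop
  | .nil => True
  | .node a l r => (∃ i, a i ≠ none) ∧ IsConvolution l ∧ IsConvolution r ∧
      ∀ i, a i = none → component i l = .nil ∧ component i r = .nil

theorem isConvolution_convolution {A : Type} {n : ℕ} (t : Fin n → BinaryTree A) :
    IsConvolution (convolution t) := by
  induction t using convolution_induction with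
  | nil t h => rw [convolution_eq_nil h]; trivial
  | node t h hl hr =>
    rw [convolution_of_exists h]
    refine ⟨by simpa [rootLabel_eq_none] using h, hl, hr, fun i hi => ?_⟩
    rw [rootLabel_eq_none] at hi
    simp [component_convolution, hi, BinaryTree.left, BinaryTree.right]

/-- `component` cuts a track at its first padding symbol; the last clause of `IsConvolution` ensures
that nothing is lost below the cut. -/
theorem convolution_component {A : Type} {n : ℕ} {c : BinaryTree (Fin n → Option A)}
    (hc : IsConvolution c) : convolution (fun i => component i c) = c := by
  induction c with
  | nil => exact convolution_eq_nil (by simp [component])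
  | node a l r hl hr =>
    obtain ⟨⟨i, hi⟩, hcl, hcr, hn⟩ := hc
    have hroot : ∀ j, rootLabel (component j (.node a l r)) = a j := by
      intro j; rw [component]; cases a j <;> simp [rootLabel]
    have hleft : ∀ j, (component j (.node a l r)).left = component j l := by
      intro j
      rw [component]
      cases h : a j with
      | none => simp [BinaryTree.left, (hn j h).1]
      | some x => simp [BinaryTree.left]
    have hright : ∀ j, (component j (.node a l r)).right = component j r := by
      intro j
      rw [component]
      cases h : a j with
      | none => simp [BinaryTree.right, (hn j h).2]
      | some x => simp [BinaryTree.right]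
    rw [convolution_of_exists ⟨i, by rwa [Ne, ← rootLabel_eq_none, hroot]⟩]
    simp only [hroot, hleft, hright, hl hcl, hr hcr]

/-- Recognizable relations between nonempty trees are tree-automatic. -/
theorem IsRecognizable.isTreeAutomaticRel {A : Type} {n : ℕ} {p : (Fin n → BinaryTree A) → Prop}
    (hp : IsRecognizable p) (hne : ∀ t, p t → ∃ i, t i ≠ .nil) : IsTreeAutomaticRel {t | p t} := by
  classical
  obtain ⟨E, hE, e, g, h, he, hh⟩ := hp
  -- Trees that are not convolutions must be rejected. Besides the value of `e`, the state records
  -- whether the tree is a convolution and which components are empty, the latter to check the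
  -- padding condition.
  let D := E × Prop × (Fin n → Prop)
  let d : D := (e fun _ => .nil, True, fun _ => True)
  let G : (Fin n → Option A) → D → D → D := fun a x y =>
    (g a x.1 y.1, (∃ i, a i ≠ none) ∧ x.2.1 ∧ y.2.1 ∧ ∀ i, a i = none → x.2.2 i ∧ y.2.2 i,
      fun i => a i = none)
  have h₂ : ∀ c, (foldTree d G c).2.2 = fun i => component i c = .nil := by
    intro c
    cases c with
    | nil => simp [foldTree, d, component]
    | node a l r =>
      funext i
      simp only [foldTree, component, G]
      cases a i <;> simp
  have h₁ : ∀ c, (foldTree d G c).2.1 = IsConvolution c := by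
    intro c
    induction c with
    | nil => rfl
    | node a l r hl hr =>
      simp only [foldTree, IsConvolution, ← hl, ← hr, G, h₂]
  have h₀ : ∀ t, (foldTree d G (convolution t)).1 = e t := by
    intro t
    induction t using convolution_induction with
    | nil t ht =>
      rw [convolution_eq_nil ht]
      simp only [not_exists, not_not] at ht
      rw [funext ht]; rfl
    | node t ht hl hr =>
      rw [convolution_of_exists ht, he t ht, ← hl, ← hr]; rfl
  have := isRegular_foldTree d G {x | x.2.1 ∧ h x.1}
  refine (congrArg IsRegular ?_).mp this
  ext c
  simp only [Set.mem_ofPred_eq, Set.mem_image, h₁]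
  constructor
  · rintro ⟨-, hc, hx⟩
    refine ⟨_, ?_, convolution_component hc⟩
    rw [hh, ← h₀, convolution_component hc]
    exact hx
  · rintro ⟨t, ht, rfl⟩
    refine ⟨?_, isConvolution_convolution t, by rwa [h₀, ← hh]⟩
    rw [convolution_of_exists (hne t ht)]
    simp

end TreeAut

namespace TreeAut

/-! ### Ordinals below `ω ^ ω ^ ω` as trees -/

open Ordinal

/-- The ordinal coded by a tree: at level `0` the length of the right spine, and at level `n + 1`
the number whose digits in base `ω ^ ω ^ n`, from the least significant one on, are coded at level
`n` by the left subtrees along the right spine. -/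
noncomputable def codeVal : BinaryTree Unit → ℕ → Ordinal.{0}
  | .nil, _ => 0
  | .node _ _ r, 0 => codeVal r 0 + 1
  | .node _ l r, n + 1 => ω ^ ω ^ (n : Ordinal.{0}) * codeVal r (n + 1) + codeVal l n

/-- The normal forms among the codes at level `n`. -/
def IsCode : BinaryTree Unit → ℕ → Prop
  | .nil, _ => True
  | .node _ l r, 0 => l = .nil ∧ IsCode r 0
  -- The last clause forbids a most significant digit 0.
  | .node _ l r, n + 1 => IsCode l n ∧ IsCode r (n + 1) ∧ ¬ (l = .nil ∧ r = .nil)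

@[simp]
theorem codeVal_nil (n : ℕ) : codeVal .nil n = 0 := by
  rw [codeVal]

/-- Since `nil` has empty subtrees, the recursion holds for it too; numerals of different lengths
can therefore be compared without padding. -/
theorem codeVal_succ (t : BinaryTree Unit) (n : ℕ) : codeVal t (n + 1) =
    ω ^ ω ^ (n : Ordinal.{0}) * codeVal t.right (n + 1) + codeVal t.left n := by
  cases t with
  | nil => simp [BinaryTree.left, BinaryTree.right]
  | node a l r => rw [codeVal]; rfl

/-- Ordinals of the form `ω ^ ω ^ (n + 1)` are closed under addition and multiplication, so no
finite numeral in a smaller base reaches them. At level `n` this is also the bound on the digits of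
level `n + 1`. -/
theorem codeVal_lt (t : BinaryTree Unit) (n : ℕ) : codeVal t n < ω ^ ω ^ (n : Ordinal.{0}) := by
  induction t generalizing n with
  | nil => rw [codeVal_nil]; exact opow_pos _ omega0_pos
  | node a l r hl hr =>
    cases n with
    | zero =>
      have := hr 0
      rw [codeVal]
      simp only [Nat.cast_zero, opow_zero, opow_one] at this ⊢
      exact isSuccLimit_omega0.add_one_lt this
    | succ n =>
      have h : ω ^ ω ^ (n : Ordinal.{0}) < ω ^ ω ^ ((n + 1 : ℕ) : Ordinal.{0}) :=
        (opow_lt_opow_iff_right one_lt_omega0).2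
          ((opow_lt_opow_iff_right one_lt_omega0).2 (by exact_mod_cast n.lt_succ_self))
      rw [codeVal]
      exact isPrincipal_add_omega0_opow _
        (isPrincipal_mul_omega0_opow_opow _ h (hr _)) ((hl n).trans h)

/-- Numbers with two digits are compared lexicographically. -/
theorem cmp_mul_add {b x y x' y' : Ordinal.{0}} (hy : y < b) (hy' : y' < b) :
    cmp (b * x + y) (b * x' + y') = (cmp x x').then (cmp y y') := by
  have key : ∀ {x y x' y' : Ordinal.{0}}, y < b → x < x' → b * x + y < b * x' + y' := by
    intro x y x' y' hy hx
    calc b * x + y < b * x + b := by gcongr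
      _ = b * Order.succ x := (mul_succ _ _).symm
      _ ≤ b * x' := by gcongr; exact Order.succ_le_of_lt hx
      _ ≤ b * x' + y' := le_self_add
  rcases lt_trichotomy x x' with h | rfl | h
  · rw [(key hy h).cmp_eq_lt, h.cmp_eq_lt]; rfl
  · rw [cmp_self_eq_eq]
    rcases lt_trichotomy y y' with h | rfl | h
    · rw [h.cmp_eq_lt, LT.lt.cmp_eq_lt (by gcongr)]; rfl
    · rw [cmp_self_eq_eq, cmp_self_eq_eq]; rfl
    · rw [h.cmp_eq_gt, LT.lt.cmp_eq_gt (by gcongr)]; rfl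
  · rw [(key hy' h).cmp_eq_gt, h.cmp_eq_gt]; rfl

/-- More significant digits sit deeper on the right spine, so the right subtrees decide first. Only
values of `Ordering` are passed upwards, hence finitely many states suffice. -/
theorem cmp_codeVal_succ (t t' : BinaryTree Unit) (n : ℕ) :
    cmp (codeVal t (n + 1)) (codeVal t' (n + 1)) =
      (cmp (codeVal t.right (n + 1)) (codeVal t'.right (n + 1))).then
        (cmp (codeVal t.left n) (codeVal t'.left n)) := by
  rw [codeVal_succ t, codeVal_succ t', cmp_mul_add (codeVal_lt _ _) (codeVal_lt _ _)]

theorem codeVal_succ_eq_iff {t t' : BinaryTree Unit} {n : ℕ} :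
    codeVal t (n + 1) = codeVal t' (n + 1) ↔
      codeVal t.right (n + 1) = codeVal t'.right (n + 1) ∧
        codeVal t.left n = codeVal t'.left n := by
  rw [← cmp_eq_eq_iff, cmp_codeVal_succ, Ordering.then_eq_eq, cmp_eq_eq_iff, cmp_eq_eq_iff]

theorem IsCode.eq_of_codeVal_eq {t t' : BinaryTree Unit} {n : ℕ} (ht : IsCode t n)
    (ht' : IsCode t' n) (h : codeVal t n = codeVal t' n) : t = t' := by
  -- Only the empty tree is a normal form of 0. This uses the ban on leading zeros and settles
  -- numerals of different lengths.
  have nil : ∀ {t : BinaryTree Unit} {n : ℕ}, IsCode t n → codeVal t n = 0 → t = .nil := by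
    intro t
    induction t with
    | nil => intros; rfl
    | node a l r hl hr =>
      rintro (_ | n) ht h
      · simp [codeVal] at h
      · rw [← codeVal_nil (n + 1), codeVal_succ_eq_iff] at h
        simp only [BinaryTree.left, BinaryTree.right, codeVal_nil] at h
        exact absurd ⟨hl ht.1 h.2, hr ht.2.1 h.1⟩ ht.2.2
  induction t generalizing t' n with
  | nil => exact (nil ht' (by simpa using h.symm)).symm
  | node a l r hl hr =>
    cases t' with
    | nil => exact nil ht (by simpa using h)
    | node a' l' r' =>
      cases n with
      | zero =>
        rw [codeVal, codeVal] at h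
        rw [ht.1, ht'.1, hr ht.2 ht'.2 (by simpa using h)]
      | succ n =>
        rw [codeVal_succ_eq_iff] at h
        rw [hl ht.1 ht'.1 h.2, hr ht.2.1 ht'.2.1 h.1]

/-- Division with remainder by the base `b` yields the last digit and a quotient to be coded
further. As `ω ^ ω ^ (n + 1) = b ^ ω`, the ordinal lies below some finite power of `b`, so finitely
many digits are enough. -/
theorem exists_isCode_codeVal_eq {n : ℕ} {α : Ordinal.{0}} (h : α < ω ^ ω ^ (n : Ordinal.{0})) :
    ∃ t, IsCode t n ∧ codeVal t n = α := by
  induction n generalizing α with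
  | zero =>
    simp only [Nat.cast_zero, opow_zero, opow_one] at h
    obtain ⟨k, rfl⟩ := lt_omega0.1 h
    clear h
    induction k with
    | zero => exact ⟨.nil, trivial, by simp⟩
    | succ k ih =>
      obtain ⟨t, ht, hk⟩ := ih
      exact ⟨.node () .nil t, ⟨rfl, ht⟩, by rw [codeVal, hk]; simp⟩
  | succ n ih =>
    set b := ω ^ ω ^ (n : Ordinal.{0})
    have hb0 : b ≠ 0 := (opow_pos _ omega0_pos).ne'
    have hlim : ω ^ ω ^ ((n + 1 : ℕ) : Ordinal.{0}) = b ^ ω := by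
      rw [Nat.cast_succ, opow_add, opow_one, opow_mul]
    rw [hlim, lt_opow_of_isSuccLimit hb0 isSuccLimit_omega0] at h
    obtain ⟨k, hk, h⟩ := h
    obtain ⟨k, rfl⟩ := lt_omega0.1 hk
    clear hk
    induction k generalizing α with
    | zero => exact ⟨.nil, trivial, by simpa [eq_comm] using h⟩
    | succ k ihk =>
      -- Zero is split off because a node with two empty subtrees is not a normal form.
      rcases eq_or_ne α 0 with rfl | hα
      · exact ⟨.nil, trivial, by simp⟩
      obtain ⟨r, hr, hrv⟩ := ihk (α := α / b) (by
        rw [← lt_mul_iff_div_lt hb0, ← opow_one_add]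
        convert h using 2
        exact_mod_cast add_comm 1 k)
      obtain ⟨l, hl, hlv⟩ := ih (mod_lt α hb0)
      have hv : codeVal (.node () l r) (n + 1) = α := by
        rw [codeVal, hrv, hlv, div_add_mod]
      refine ⟨.node () l r, ⟨hl, hr, ?_⟩, hv⟩
      rintro ⟨rfl, rfl⟩
      exact hα (by simpa [codeVal] using hv.symm)

theorem exists_lt_omega0_opow_opow_natCast {α : Ordinal.{0}} (h : α < ω ^ ω ^ ω) :
    ∃ n : ℕ, α < ω ^ ω ^ (n : Ordinal.{0}) := by
  rw [lt_opow_of_isSuccLimit omega0_ne_zero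
    (isSuccLimit_opow one_lt_omega0 isSuccLimit_omega0)] at h
  obtain ⟨c, hc, h⟩ := h
  rw [lt_opow_of_isSuccLimit omega0_ne_zero isSuccLimit_omega0] at hc
  obtain ⟨m, hm, hc⟩ := hc
  obtain ⟨n, rfl⟩ := lt_omega0.1 hm
  exact ⟨n, h.trans ((opow_lt_opow_iff_right one_lt_omega0).2 hc)⟩

/-! ### Recognizability of the coding -/

theorem isRecognizable_eq_nil {A : Type} :
    IsRecognizable fun t : Fin 1 → BinaryTree A => t 0 = .nil := by
  -- The recursion is required only at nonempty tuples, so the value at `nil` is unconstrained.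
  refine (IsRecognizable.const 1 ()).of_recursion (fun _ _ _ _ _ => False) fun t ht => ?_
  simpa using ht

theorem isRecognizable_isCode (n : ℕ) :
    IsRecognizable fun t : Fin 1 → BinaryTree Unit => IsCode (t 0) n := by
  induction n with
  | zero =>
    refine isRecognizable_eq_nil.of_recursion (fun _ x _ _ y => x ∧ y) fun t ht => ?_
    cases h : t 0 with
    | nil => simp [h] at ht
    | node a l r => simp [h, IsCode, BinaryTree.left, BinaryTree.right]
  | succ n ih =>
    refine (isRecognizable_eq_nil.prodMk ih).of_recursion
      (fun _ x y _ z => x.2 ∧ z ∧ ¬ (x.1 ∧ y.1)) fun t ht => ?_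
    cases h : t 0 with
    | nil => simp [h] at ht
    | node a l r => simp [h, IsCode, BinaryTree.left, BinaryTree.right]

theorem cmp_add_one (x y : Ordinal.{0}) : cmp (x + 1) (y + 1) = cmp x y := by
  rcases lt_trichotomy x y with h | rfl | h
  · rw [h.cmp_eq_lt, LT.lt.cmp_eq_lt (by simpa using h)]
  · simp
  · rw [h.cmp_eq_gt, LT.lt.cmp_eq_gt (by simpa using h)]

theorem cmp_zero_add_one (x : Ordinal.{0}) : cmp 0 (x + 1) = .lt :=
  LT.lt.cmp_eq_lt (by simp)

theorem cmp_add_one_zero (x : Ordinal.{0}) : cmp (x + 1) 0 = .gt :=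
  LT.lt.cmp_eq_gt (by simp)

theorem isRecognizable_cmp_codeVal (n : ℕ) : IsRecognizable fun t : Fin 2 → BinaryTree Unit =>
    cmp (codeVal (t 0) n) (codeVal (t 1) n) := by
  induction n with
  | zero =>
    -- The number whose right spine ends first is the smaller one; both labels are never `none` at a
    -- node.
    refine (IsRecognizable.const 2 ()).of_recursion (fun a _ _ _ y => match a 0, a 1 with
      | none, _ => .lt
      | some _, none => .gt
      | some _, some _ => y) fun t ht => ?_
    cases h : t 0 with
    | nil =>
      cases h' : t 1 with
      | nil => simp [h, h'] at ht
      | node a l r => simp [h, h', rootLabel, codeVal, cmp_zero_add_one]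
    | node a l r =>
      cases h' : t 1 with
      | nil => simp [h, h', rootLabel, codeVal, cmp_add_one_zero]
      | node a l r => simp [h, h', rootLabel, codeVal, cmp_add_one, BinaryTree.right]
  | succ n ih =>
    exact ih.of_recursion (fun _ x _ _ y => y.then x) fun t _ => cmp_codeVal_succ _ _ n

/-- Descending in the input also descends in the constant `s`, so comparisons with its subtrees
enter as functions already known to be recognizable. Once `s` is exhausted, the constant stays `nil`
and the recursion is a genuine one. -/
theorem isRecognizable_cmp_codeVal_const (s : BinaryTree Unit) (n : ℕ) :
    IsRecognizable fun t : Fin 1 → BinaryTree Unit => cmp (codeVal (t 0) n) (codeVal s n) := by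
  induction s generalizing n with
  | nil =>
    induction n with
    | zero =>
      refine (IsRecognizable.const 1 ()).of_recursion (fun _ _ _ _ _ => .gt) fun t ht => ?_
      cases h : t 0 with
      | nil => simp [h] at ht
      | node a l r => simp [codeVal]
    | succ n ih =>
      exact ih.of_recursion (fun _ x _ _ y => y.then x) fun t _ => cmp_codeVal_succ _ _ n
  | node a l r hl hr =>
    cases n with
    | zero =>
      refine (hr 0).of_recursion (fun _ _ y _ _ => y) fun t ht => ?_
      cases h : t 0 with
      | nil => simp [h] at ht
      | node a l r => simp [h, codeVal, cmp_add_one, BinaryTree.right]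
    | succ n =>
      exact ((hl n).prodMk (hr (n + 1))).of_recursion (fun _ x y _ _ => y.2.then x.1)
        fun t _ => cmp_codeVal_succ _ _ n

end TreeAut

namespace TreeAut

open FirstOrder CategoryTheory Ordinal

/-! ### Structures of partial orders -/

/-- An order embedding, as an embedding of structures. -/
def orderStrEmbedding {P Q : Type} [PartialOrder P] [PartialOrder Q] (f : P ↪o Q) :
    orderStr P ↪[Language.order] orderStr Q where
  toFun := f
  inj' := f.injective
  map_fun' g := isEmptyElim g
  map_rel' := by rintro _ ⟨⟩ x; exact f.le_iff_le

theorem ltRel_orderStr {P : Type} [PartialOrder P] {x y : P} :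
    ltRel (orderStr P) x y ↔ x < y :=
  lt_iff_le_and_ne.symm

theorem isWellFoundedOrder_orderStr (P : Type) [PartialOrder P] [Countable P] [WellFoundedLT P] :
    IsWellFoundedOrder (orderStr P) where
  countable := ‹Countable P›
  partialOrder :=
    { refl := fun x => le_refl (α := P) x
      trans := fun x y z => le_trans (α := P) (a := x) (b := y) (c := z)
      antisymm := fun x y => le_antisymm (α := P) (a := x) (b := y) }
  wf := Subrelation.wf ltRel_orderStr.1 (wellFounded_lt (α := P))

/-- A strictly monotone map to the ordinals whose values below `f q` are taken below `q`
computes the rank. -/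
theorem rank_orderStr_eq {P : Type} [PartialOrder P] (h : IsWellFoundedOrder (orderStr P))
    {f : P → Ordinal.{0}} (hf : StrictMono f) (hf' : ∀ q, ∀ c < f q, ∃ p < q, f p = c) :
    rank (orderStr P) h = ⨆ p, Order.succ (f p) := by
  have key : ∀ q, (h.wf.apply q).rank = f q := by
    intro q
    induction q using h.wf.induction with
    | _ q ih =>
      rw [Acc.rank_eq]
      apply le_antisymm
      · refine Ordinal.iSup_le fun p => ?_
        rw [ih p p.2, Order.succ_le_iff]
        exact hf (ltRel_orderStr.1 p.2)
      · refine le_of_forall_lt fun c hc => ?_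
        obtain ⟨p, hp, rfl⟩ := hf' q c hc
        rw [← ih p (ltRel_orderStr.2 hp), ← Order.succ_le_iff]
        exact Ordinal.le_iSup (fun b : {b // ltRel (orderStr P) b q} =>
          Order.succ ((h.wf.apply q).inv b.2).rank) ⟨p, ltRel_orderStr.2 hp⟩
  exact iSup_congr fun q => congrArg Order.succ (key q)

/-! ### Antichains -/

theorem antichain_not_lt {X : Type} (x y : Antichain X) : ¬ x < y :=
  fun h => h.ne h.le

instance {X : Type} : WellFoundedLT (Antichain X) :=
  ⟨⟨fun x => ⟨x, fun y h => absurd h (antichain_not_lt y x)⟩⟩⟩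

theorem rank_antichain (X : Type) [Countable X] [Nonempty X] :
    ∃ h : IsWellFoundedOrder (orderStr (Antichain X)), rank (orderStr (Antichain X)) h = 1 := by
  have : Countable (Antichain X) := ‹Countable X›
  have : Nonempty (Antichain X) := ‹Nonempty X›
  refine ⟨isWellFoundedOrder_orderStr _, ?_⟩
  rw [rank_orderStr_eq _ (f := fun _ => 0) (fun x y h => absurd h (antichain_not_lt x y))
    (fun q c hc => (not_lt_zero hc).elim)]
  simp

/-! ### Strict products -/

namespace StrictProduct

variable {X Y : Type}

instance [PartialOrder X] [PartialOrder Y] [WellFoundedLT X] :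
    WellFoundedLT (StrictProduct X Y) :=
  ⟨Subrelation.wf (fun h => h.1) (InvImage.wf fst (wellFounded_lt (α := X)))⟩

/-- A nonempty chain has a least element, and its natural number bounds those of all the others.
Distinct comparable elements have distinct second coordinates, so the chain injects into a finite
set. -/
theorem finite_of_isChain [PartialOrder X] [WellFoundedLT X]
    (s : Set (StrictProduct X ℕᵒᵈ)) (hs : IsChain (· ≤ ·) s) : s.Finite := by
  rcases s.eq_empty_or_nonempty with rfl | hne
  · exact Set.finite_empty
  obtain ⟨m, hm, hmin⟩ := (wellFounded_lt (α := StrictProduct X ℕᵒᵈ)).has_min s hne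
  refine Set.Finite.of_finite_image (f := snd) ?_ ?_
  · refine ((Set.finite_Iic (OrderDual.ofDual m.snd)).image OrderDual.toDual).subset ?_
    rintro _ ⟨q, hq, rfl⟩
    refine ⟨OrderDual.ofDual q.snd, ?_, rfl⟩
    rcases hs.total hm hq with (rfl | h) | (rfl | h)
    · exact le_refl (OrderDual.ofDual m.snd)
    · exact h.2.le
    · exact le_refl (OrderDual.ofDual q.snd)
    · exact absurd h (hmin q hq)
  · intro p hp q hq hpq
    rcases hs.total hp hq with (h | h) | (h | h)
    · exact h
    · exact absurd hpq h.2.ne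
    · exact h.symm
    · exact absurd hpq h.2.ne'

/-- The fibres of the first projection are antichains. -/
def fstFibre [PartialOrder X] [PartialOrder Y] (x : X) :
    {p : StrictProduct X Y | p.fst = x} ≃o Antichain Y where
  toFun p := p.1.snd
  invFun y := ⟨⟨x, y⟩, rfl⟩
  left_inv := by rintro ⟨⟨_, y⟩, rfl⟩; rfl
  right_inv _ := rfl
  map_rel_iff' := by
    rintro ⟨p, rfl⟩ ⟨q, hq⟩
    constructor
    · exact fun h => Or.inl (StrictProduct.ext (Eq.symm hq) h)
    · rintro (h | h)
      · exact congrArg snd h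
      · exact absurd (Eq.symm hq) h.1.ne

/-- The fibres of the second projection are antichains. -/
def sndFibre [PartialOrder X] [PartialOrder Y] (y : Y) :
    {p : StrictProduct X Y | p.snd = y} ≃o Antichain X where
  toFun p := p.1.fst
  invFun x := ⟨⟨x, y⟩, rfl⟩
  left_inv := by rintro ⟨⟨x, _⟩, rfl⟩; rfl
  right_inv _ := rfl
  map_rel_iff' := by
    rintro ⟨p, rfl⟩ ⟨q, hq⟩
    constructor
    · exact fun h => Or.inl (StrictProduct.ext h (Eq.symm hq))
    · rintro (h | h)
      · exact congrArg fst h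
      · exact absurd (Eq.symm hq) h.2.ne

/-- The decomposition of a strict product into its two factors. -/
def piEquiv (X Y : Type) [PartialOrder X] [PartialOrder Y] :
    (∀ i, (![orderStr (Antichain X), orderStr (Antichain Y)] : Fin 2 → Bundled _) i) ≃
      orderStr (StrictProduct X Y) where
  toFun f := (⟨f 0, f 1⟩ : StrictProduct X Y)
  invFun p := fun i => match i with
    | 0 => fst p
    | 1 => snd p
  left_inv f := by funext i; match i with
    | 0 => rfl
    | 1 => rfl
  right_inv p := rfl

theorem le_iff_cmp [LinearOrder X] [LinearOrder Y] {p q : StrictProduct X Y} :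
    p ≤ q ↔ (cmp p.fst q.fst = .eq ∧ cmp p.snd q.snd = .eq) ∨
      (cmp p.fst q.fst = .lt ∧ cmp p.snd q.snd = .lt) := by
  rw [cmp_eq_eq_iff, cmp_eq_eq_iff, cmp_eq_lt_iff, cmp_eq_lt_iff, ← StrictProduct.ext_iff]
  rfl

/-- A coloring of an antichain need only determine equality and may carry more information: here it
is `cmp` in the linear order that the antichain has forgotten. The two colors together decide the
order of the product. -/
theorem isTamelyColorableBoxAugmentation [LinearOrder X] [LinearOrder Y] :
    IsTamelyColorableBoxAugmentation (orderStr (StrictProduct X Y))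
      ![orderStr (Antichain X), orderStr (Antichain Y)] := by
  refine ⟨piEquiv X Y, fun k d => ?_, ?_⟩
  · match k with
    | 0 => exact ⟨orderStrEmbedding ((sndFibre (X := X) (Y := Y) (d 1)).symm.toOrderEmbedding.trans
        (OrderEmbedding.subtype _)), fun e => rfl⟩
    | 1 => exact ⟨orderStrEmbedding ((fstFibre (X := X) (Y := Y) (d 0)).symm.toOrderEmbedding.trans
        (OrderEmbedding.subtype _)), fun e => rfl⟩
  · rintro _ ⟨⟩
    refine ⟨fun _ => Ordering, fun i => match i with
      | 0 => fun x => cmp (α := X) (x 0) (x 1)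
      | 1 => fun y => cmp (α := Y) (y 0) (y 1), fun i => ?_, inferInstance, fun p q h => ?_⟩
    · match i with
      | 0 => exact ⟨inferInstance, fun x y h => eq_iff_eq_of_cmp_eq_cmp (α := X) (β := X) h⟩
      | 1 => exact ⟨inferInstance, fun x y h => eq_iff_eq_of_cmp_eq_cmp (α := Y) (β := Y) h⟩
    · have h₀ : cmp (fst (p 0)) (fst (p 1)) = cmp (fst (q 0)) (fst (q 1)) := congrFun h 0
      have h₁ : cmp (snd (p 0)) (snd (p 1)) = cmp (snd (q 0)) (snd (q 1)) := congrFun h 1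
      refine (le_iff_cmp (p := p 0) (q := p 1)).trans
        (Iff.trans ?_ (le_iff_cmp (p := q 0) (q := q 1)).symm)
      rw [h₀, h₁]

instance [Countable X] [Countable Y] : Countable (StrictProduct X Y) :=
  Function.Injective.countable (f := fun p : StrictProduct X Y => (p.fst, p.snd))
    fun _ _ h => StrictProduct.ext (congrArg Prod.fst h) (congrArg Prod.snd h)

end StrictProduct

theorem countable_toType {α : Ordinal.{0}} (h : α < ω₁) : Countable α.ToType := by
  rw [← Cardinal.mk_le_aleph0_iff, Cardinal.mk_toType]
  rw [← Cardinal.ord_aleph, Cardinal.lt_ord, ← Cardinal.succ_aleph0, Order.lt_succ_iff] at h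
  exact h

/-- The first coordinate is the rank function: for `c < β` the pair `(c, k + 1)` lies below `(β,
k)`. The bound `ω₁` provides countability. -/
theorem rank_ordinalTimesOmegaStar {α : Ordinal.{0}} (hα : α < ω₁) :
    ∃ h : IsWellFoundedOrder (orderStr (OrdinalTimesOmegaStar α)),
      rank (orderStr (OrdinalTimesOmegaStar α)) h = α := by
  have := countable_toType hα
  have : Countable ℕᵒᵈ := inferInstanceAs (Countable ℕ)
  refine ⟨isWellFoundedOrder_orderStr _, ?_⟩
  rw [rank_orderStr_eq _ (f := fun p => (ToType.toOrd p.fst : Ordinal.{0}))]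
  · apply le_antisymm
    · exact Ordinal.iSup_le fun p => Order.succ_le_of_lt (ToType.toOrd p.fst).2
    · refine le_of_forall_lt fun c hc => ?_
      have := Ordinal.le_iSup (fun p : OrdinalTimesOmegaStar α =>
        Order.succ (ToType.toOrd p.fst : Ordinal.{0})) ⟨ToType.mk ⟨c, hc⟩, OrderDual.toDual 0⟩
      simpa using this
  · intro p q h
    exact (ToType.mk.symm.lt_iff_lt).2 h.1
  · intro q c hc
    refine ⟨⟨ToType.mk ⟨c, hc.trans (ToType.toOrd q.fst).2⟩,
      OrderDual.toDual (OrderDual.ofDual q.snd + 1)⟩, ⟨?_, ?_⟩, by simp⟩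
    · rw [← ToType.mk.symm.lt_iff_lt]
      simpa [← Subtype.coe_lt_coe] using hc
    · exact Nat.lt_succ_self (OrderDual.ofDual q.snd)

/-! ### Tree-automatic presentations -/

/-- The trees that code an element of `OrdinalTimesOmegaStar α`. -/
def pairCodes (α : Ordinal.{0}) (n : ℕ) : Set (BinaryTree Unit) :=
  -- The root only joins the two codes; thanks to it even the pair of zeros, both coded by `nil`,
  -- becomes a nonempty tree.
  {t | t ≠ .nil ∧ IsCode t.left n ∧ codeVal t.left n < α ∧ IsCode t.right 0}

theorem isRecognizable_pairCodes {α : Ordinal.{0}} {n : ℕ} (hα : α < ω ^ ω ^ (n : Ordinal.{0})) :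
    IsRecognizable fun t : Fin 1 → BinaryTree Unit => IsCode (t 0).left n ∧
      codeVal (t 0).left n < α ∧ IsCode (t 0).right 0 := by
  -- The bound `α` is itself the value of a fixed code, so being below `α` is a comparison with a
  -- constant.
  obtain ⟨s, -, rfl⟩ := exists_isCode_codeVal_eq hα
  refine ((isRecognizable_isCode n).prodMk ((isRecognizable_cmp_codeVal_const s n).prodMk
    (isRecognizable_isCode 0))).of_recursion (fun _ x y _ _ => x.1 ∧ x.2.1 = .lt ∧ y.2.2)
    fun t ht => ?_
  simp only [cmp_eq_lt_iff]

theorem isRecognizable_mem_pairCodes {α : Ordinal.{0}} {n : ℕ}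
    (hα : α < ω ^ ω ^ (n : Ordinal.{0})) :
    IsRecognizable fun t : Fin 1 → BinaryTree Unit => t 0 ∈ pairCodes α n :=
  (isRecognizable_eq_nil.prodMk (isRecognizable_pairCodes hα)).map fun x => ¬ x.1 ∧ x.2

/-- The comparisons of the two coordinates of a pair of codes. -/
theorem isRecognizable_cmp_pair (n : ℕ) : IsRecognizable fun t : Fin 2 → BinaryTree Unit =>
    (cmp (codeVal (t 0).left n) (codeVal (t 1).left n),
      cmp (codeVal (t 0).right 0) (codeVal (t 1).right 0)) :=
  ((isRecognizable_cmp_codeVal n).prodMk (isRecognizable_cmp_codeVal 0)).of_recursion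
    (fun _ x y _ _ => (x.1, y.2)) fun _ _ => rfl

theorem cmp_natCast (k m : ℕ) : cmp (k : Ordinal.{0}) m = cmp k m :=
  Nat.strictMono_cast.cmp_map_eq k m

/-- The coding of the elements of `OrdinalTimesOmegaStar α`. -/
theorem exists_pairCodes_equiv {α : Ordinal.{0}} {n : ℕ} (hα : α < ω ^ ω ^ (n : Ordinal.{0})) :
    ∃ e : OrdinalTimesOmegaStar α ≃ pairCodes α n, ∀ p q, p ≤ q ↔
      (cmp (codeVal (e p).1.left n) (codeVal (e q).1.left n),
        cmp (codeVal (e p).1.right 0) (codeVal (e q).1.right 0)) ∈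
          ({(.eq, .eq), (.lt, .gt)} : Set (Ordering × Ordering)) := by
  choose c hc hcv using fun β : α.ToType =>
    exists_isCode_codeVal_eq (n := n) (α := ToType.toOrd β) ((ToType.toOrd β).2.trans hα)
  choose d hd hdv using fun k : ℕ =>
    exists_isCode_codeVal_eq (n := 0) (α := k) (by simp)
  let F : OrdinalTimesOmegaStar α → pairCodes α n := fun p =>
    ⟨.node () (c p.fst) (d (OrderDual.ofDual p.snd)), by simp, hc _,
      (hcv _).trans_lt (ToType.toOrd p.fst).2, hd _⟩
  have hF₁ : ∀ p, codeVal (F p).1.left n = ToType.toOrd p.fst := fun p => hcv _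
  have hF₂ : ∀ p, codeVal (F p).1.right 0 = OrderDual.ofDual p.snd := fun p => hdv _
  have hF : Function.Bijective F := by
    constructor
    · intro p q h
      have h₁ := hF₁ p
      have h₂ := hF₂ p
      rw [h, hF₁] at h₁
      rw [h, hF₂] at h₂
      exact StrictProduct.ext (ToType.mk.symm.injective (Subtype.ext h₁.symm))
        (OrderDual.ofDual.injective (by exact_mod_cast h₂.symm))
    · rintro ⟨t, ht, hl, hlt, hr⟩
      have hω := codeVal_lt t.right 0
      simp only [Nat.cast_zero, opow_zero, opow_one] at hω
      obtain ⟨k, hk⟩ := lt_omega0.1 hω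
      refine ⟨⟨ToType.mk ⟨codeVal t.left n, hlt⟩, OrderDual.toDual k⟩, Subtype.ext ?_⟩
      cases t with
      | nil => exact absurd rfl ht
      | node a l r =>
        change BinaryTree.node () _ _ = BinaryTree.node () _ _
        congr 1
        · exact (hc _).eq_of_codeVal_eq hl ((hcv _).trans (by simp [BinaryTree.left]))
        · exact (hd _).eq_of_codeVal_eq hr ((hdv _).trans hk.symm)
  refine ⟨Equiv.ofBijective F hF, fun p q => ?_⟩
  have h₁ : cmp (ToType.toOrd p.fst : Ordinal.{0}) (ToType.toOrd q.fst) = cmp p.fst q.fst :=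
    (ToType.mk.symm.strictMono).cmp_map_eq p.fst q.fst
  -- Codes compare natural numbers as in `ω`, so a strict increase in `ω*` shows up as `.gt`.
  have h₂ : cmp (OrderDual.ofDual p.snd) (OrderDual.ofDual q.snd) = cmp q.snd p.snd :=
    cmp_ofDual p.snd q.snd
  rw [Equiv.ofBijective_apply, Equiv.ofBijective_apply, hF₁, hF₁, hF₂, hF₂, cmp_natCast, h₁, h₂,
    StrictProduct.le_iff_cmp]
  rw [Set.mem_insert_iff, Set.mem_singleton_iff, Prod.mk.injEq, Prod.mk.injEq]
  simp only [cmp_eq_eq_iff, cmp_eq_lt_iff, cmp_eq_gt_iff, eq_comm (a := q.snd)]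

theorem isTreeAutomatic_ordinalTimesOmegaStar {α : Ordinal.{0}} (hα : α < ω ^ ω ^ ω) :
    IsTreeAutomatic (orderStr (OrdinalTimesOmegaStar α)) := by
  obtain ⟨n, hn⟩ := exists_lt_omega0_opow_opow_natCast hα
  obtain ⟨e, he⟩ := exists_pairCodes_equiv hn
  let : Language.order.Structure (OrdinalTimesOmegaStar α) := Language.orderStructure _
  refine ⟨Unit, inferInstance, pairCodes α n, e.inducedStructure,
    (isRecognizable_pairCodes hn).isRegular, ?_, ⟨e.inducedStructureEquiv⟩⟩
  rintro _ ⟨⟩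
  have hmem := isRecognizable_mem_pairCodes hn
  -- The automaton sees arbitrary pairs of trees, so membership of both in the domain is checked
  -- along with the comparisons.
  have hrec := ((hmem.comp_reindex fun _ => (0 : Fin 2)).prodMk
    ((hmem.comp_reindex fun _ => (1 : Fin 2)).prodMk (isRecognizable_cmp_pair n))).map fun x =>
      x.1 ∧ x.2.1 ∧ x.2.2 ∈ ({(.eq, .eq), (.lt, .gt)} : Set (Ordering × Ordering))
  refine (congrArg IsTreeAutomaticRel ?_).mp
    (hrec.isTreeAutomaticRel fun t ht => ⟨0, ht.1.1⟩)
  ext t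
  have hrel : ∀ x : Fin 2 → pairCodes α n, e.symm (x 0) ≤ e.symm (x 1) ↔
      (cmp (codeVal (x 0).1.left n) (codeVal (x 1).1.left n),
        cmp (codeVal (x 0).1.right 0) (codeVal (x 1).1.right 0)) ∈
          ({(.eq, .eq), (.lt, .gt)} : Set (Ordering × Ordering)) := by
    intro x
    rw [he, e.apply_symm_apply, e.apply_symm_apply]
  constructor
  · rintro ⟨h₀, h₁, h⟩
    refine ⟨![⟨t 0, h₀⟩, ⟨t 1, h₁⟩], (hrel _).2 h, ?_⟩
    funext i
    match i with
    | 0 => rfl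
    | 1 => rfl
  · rintro ⟨x, hx, rfl⟩
    exact ⟨(x 0).2, (x 1).2, (hrel x).1 hx⟩

/-! ### Failure of box-indecomposability -/

theorem not_isBoxIndecomposable {𝒞 : Set (Bundled.{0} Language.order.Structure)}
    (h𝒞 : 𝒞 ⊆ {𝔓 | IsWellFoundedOrder 𝔓}) {α₁ α₂ : Ordinal.{0}} (h₁ : 1 < α₁) (h₁₂ : α₁ ≤ α₂)
    (hα₂ : α₂ < ω₁) (hmem : orderStr (OrdinalTimesOmegaStar α₂) ∈ 𝒞) :
    ¬ IsBoxIndecomposable 𝒞 (rankOn h𝒞) α₁ α₂ := by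
  intro hbox
  have : Countable α₂.ToType := countable_toType hα₂
  have : Nonempty α₂.ToType :=
    nonempty_toType_iff.2 (zero_lt_one.trans (h₁.trans_le h₁₂)).ne'
  have : Countable ℕᵒᵈ := inferInstanceAs (Countable ℕ)
  obtain ⟨_, hrank⟩ := rank_ordinalTimesOmegaStar hα₂
  obtain ⟨i, hi, hle, -⟩ := hbox ⟨_, hmem⟩ hrank 2 _ two_pos
    StrictProduct.isTamelyColorableBoxAugmentation
  -- Whichever factor is offered, it is a nonempty antichain of rank 1, below `α₁`.
  refine hle.not_gt (lt_of_eq_of_lt ?_ h₁)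
  match i with
  | 0 => exact (rank_antichain α₂.ToType).choose_spec
  | 1 => exact (rank_antichain ℕᵒᵈ).choose_spec

theorem not_isDelhommeSequence {𝒞 : Set (Bundled.{0} Language.order.Structure)}
    {ν : 𝒞 → Ordinal.{0}} {b : Ordinal.{0}}
    (h : ∀ α₁ α₂ : Ordinal.{0}, 1 < α₁ → α₁ ≤ α₂ → α₂ < b → ¬ IsBoxIndecomposable 𝒞 ν α₁ α₂) :
    ¬ ∃ a : ℕ → Ordinal.{0}, (∀ i, a i < b) ∧ IsDelhommeSequence 𝒞 ν a := by
  rintro ⟨a, hab, ha⟩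
  -- The first two terms may be 0 and 1, so `a 2` is the first one certain to exceed 1.
  have h₁ : 1 ≤ a 1 := Order.one_le_iff_pos.2 (pos_of_gt (ha.strictMono zero_lt_one))
  exact h (a 2) (a 3) (h₁.trans_lt (ha.strictMono one_lt_two))
    (ha.strictMono (Nat.lt_succ_self 2)).le (hab 3) (ha.box_indecomposable 2)

theorem omega0_opow_opow_lt_omega_one : ω ^ ω ^ ω < (ω₁ : Ordinal.{0}) :=
  isPrincipal_opow_omega 1 omega0_lt_omega_one
    (isPrincipal_opow_omega 1 omega0_lt_omega_one omega0_lt_omega_one)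

end TreeAut

open TreeAut FirstOrder CategoryTheory Ordinal in
theorem mainTheorem11 :
    -- the product of `α` and `ω*`
    (∀ α : Ordinal.{0}, α < ω ^ ω ^ ω →
      IsTreeAutomatic (orderStr (OrdinalTimesOmegaStar α)) ∧
      (∃ h : IsWellFoundedOrder (orderStr (OrdinalTimesOmegaStar α)),
        rank (orderStr (OrdinalTimesOmegaStar α)) h = α) ∧
      (∀ s : Set (OrdinalTimesOmegaStar α), IsChain (· ≤ ·) s → s.Finite) ∧
      (∀ β : α.ToType,
        Nonempty ({p : OrdinalTimesOmegaStar α | p.fst = β} ≃o Antichain ℕᵒᵈ)) ∧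
      (∀ k : ℕᵒᵈ,
        Nonempty ({p : OrdinalTimesOmegaStar α | p.snd = k} ≃o Antichain α.ToType)) ∧
      IsTamelyColorableBoxAugmentation (orderStr (OrdinalTimesOmegaStar α))
        ![orderStr (Antichain α.ToType), orderStr (Antichain ℕᵒᵈ)]) ∧
    -- nonempty antichains have rank 1
    (∀ X : Type, Countable X → Nonempty X →
      ∃ h : IsWellFoundedOrder (orderStr (Antichain X)), rank (orderStr (Antichain X)) h = 1) ∧
    -- the decomposition technique is not applicable below `ω ^ ω ^ ω` to any class of
    -- well-founded partial orders that contains all tree-automatic ones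
    (∀ (𝒞 : Set (Bundled.{0} Language.order.Structure))
      (h𝒞 : 𝒞 ⊆ {𝔓 | IsWellFoundedOrder 𝔓}),
      {𝔓 | IsWellFoundedOrder 𝔓 ∧ IsTreeAutomatic 𝔓} ⊆ 𝒞 →
      (∀ α₁ α₂ : Ordinal.{0}, 1 < α₁ → α₁ ≤ α₂ → α₂ < ω ^ ω ^ ω →
        ¬ IsBoxIndecomposable 𝒞 (rankOn h𝒞) α₁ α₂) ∧
      ¬ ∃ a : ℕ → Ordinal.{0}, (∀ i, a i < ω ^ ω ^ ω) ∧
        IsDelhommeSequence 𝒞 (rankOn h𝒞) a) ∧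
    -- for the class of all well-founded partial orders it is not applicable at any countable level
    ((∀ α₁ α₂ : Ordinal.{0}, 1 < α₁ → α₁ ≤ α₂ → α₂ < ω₁ →
        ¬ IsBoxIndecomposable {𝔓 | IsWellFoundedOrder 𝔓} (rankOn subset_rfl) α₁ α₂) ∧
      ¬ ∃ a : ℕ → Ordinal.{0}, (∀ i, a i < ω₁) ∧
        IsDelhommeSequence {𝔓 | IsWellFoundedOrder 𝔓} (rankOn subset_rfl) a) := by
  refine ⟨fun α hα => ⟨isTreeAutomatic_ordinalTimesOmegaStar hα,
    rank_ordinalTimesOmegaStar (hα.trans omega0_opow_opow_lt_omega_one),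
    StrictProduct.finite_of_isChain, fun β => ⟨StrictProduct.fstFibre β⟩,
    fun k => ⟨StrictProduct.sndFibre k⟩, StrictProduct.isTamelyColorableBoxAugmentation⟩,
    fun X _ _ => rank_antichain X, fun 𝒞 h𝒞 hsub => ?_, ?_⟩
  · have h : ∀ α₁ α₂ : Ordinal.{0}, 1 < α₁ → α₁ ≤ α₂ → α₂ < ω ^ ω ^ ω →
        ¬ IsBoxIndecomposable 𝒞 (rankOn h𝒞) α₁ α₂ := fun α₁ α₂ h₁ h₁₂ h₂ =>
      have h₂' := h₂.trans omega0_opow_opow_lt_omega_one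
      not_isBoxIndecomposable h𝒞 h₁ h₁₂ h₂'
        (hsub ⟨(rank_ordinalTimesOmegaStar h₂').choose, isTreeAutomatic_ordinalTimesOmegaStar h₂⟩)
    exact ⟨h, not_isDelhommeSequence h⟩
  · have h : ∀ α₁ α₂ : Ordinal.{0}, 1 < α₁ → α₁ ≤ α₂ → α₂ < ω₁ →
        ¬ IsBoxIndecomposable {𝔓 | IsWellFoundedOrder 𝔓} (rankOn subset_rfl) α₁ α₂ :=
      fun α₁ α₂ h₁ h₁₂ h₂ =>
        not_isBoxIndecomposable subset_rfl h₁ h₁₂ h₂ (rank_ordinalTimesOmegaStar h₂).choose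
    exact ⟨h, not_isDelhommeSequence h⟩
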